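/- Let $m$ be a number of bosonic modes and let $\mathcal H=\ell^2(\mathbb N^m)$ be the $m$-mode Fock space, with Fock basis $|n\rangle=|n_1,\dots,n_m\rangle$ and vacuum $|0\rangle=|0,\dots,0\rangle$; the case $m=1$ is the single-mode case. Let $\mathcal S\subset\mathcal H$ be the Schwartz space of vectors $\sum_n c_n|n\rangle$ such that $(n_1+\cdots+n_m)^k c_n\to 0$ as $n\to\infty$ for every $k\in\mathbb N$. For each mode $j$, let $\hat a_j,\hat a_j^\dagger$ be the annihilation and creation operators ($\hat a_j^\dagger|n\rangle=\sqrt{n_j+1}\,|n+e_j\rangle$, $\hat a_j|n+e_j\rangle=\sqrt{n_j+1}\,|n\rangle$, and $\hat a_j|n\rangle=0$ if $n_j=0$), and let $\hat q_j=\frac{1}{\sqrt2}(\hat a_j+\hat a_j^\dagger)$, $\hat p_j=\frac{1}{i\sqrt2}(\hat a_j-\hat a_j^\dagger)$, all acting on $\mathcal S$. A polynomial Hamiltonian is an operator $P(\hat q_1,\hat p_1,\dots,\hat q_m,\hat p_m)$ with domain $\mathcal S$, where $P$ is a noncommutative polynomial with complex coefficients, which is Hermitian: $\langle P\phi,\chi\rangle=\langle\phi,P\chi\rangle$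 for all $\phi,\chi\in\mathcal S$. For density operators write $D(\rho,\sigma)=\frac12\|\rho-\sigma\|_1=\frac12\operatorname{Tr}|\rho-\sigma|$. Fix an evolution time $T>0$. For every unit vector $|\psi\rangle\in\mathcal H$ and every $\epsilon>0$ there is a polynomial Hamiltonian $P_\epsilon(\hat q_1,\hat p_1,\dots,\hat q_m,\hat p_m)$ such that the Schrödinger equation $$i\,\frac{d}{dt}\phi(t)=P_\epsilon(\hat q_1,\hat p_1,\dots,\hat q_m,\hat p_m)\,\phi(t),\qquad \phi(0)=|0\rangle,\qquad 0\le t\le T,$$ has a solution $\phi$ (with values in $\mathcal S$ and differentiable in the norm of $\mathcal H$), this solution is unique, also among the solutions of the same equation for any symmetric operator extending $P_\epsilon(\hat q_1,\hat p_1,\dots,\hat q_m,\hat p_m)$, and the state $|\psi_\epsilon\rangle=\phi(T)$ satisfies $$D\big(|\psi\rangle\langle\psi|,\,|\psi_\epsilon\rangle\langle\psi_\epsilon|\big)\le\epsilon .$$ -/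

import Mathlib

open scoped InnerProductSpace lp ENNReal

/-- The Hilbert space of `m` bosonic modes: square-summable families of coefficients in the Fock
basis `|n₁, …, n_m⟩`, i.e. the `m`-fold Hilbert tensor power of the single-mode space `ℓ²(ℕ)`. -/
abbrev Fock (m : ℕ) : Type := ℓ²(Fin m → ℕ, ℂ)

/-- The Fock basis vector `|n₁, …, n_m⟩`. -/
noncomputable def fockState {m : ℕ} (n : Fin m → ℕ) : Fock m := lp.single 2 n (1 : ℂ)

/-- The vacuum state `|0, …, 0⟩`. -/
noncomputable def vacuum (m : ℕ) : Fock m := fockState 0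

/-- Faster than polynomial decay of a family of Fock coefficients: for every `k`, the quantity
`(n₁ + ⋯ + n_m) ^ k * |c n|` tends to `0` as `n` leaves every finite set. -/
def RapidDecay {m : ℕ} (c : (Fin m → ℕ) → ℂ) : Prop :=
  ∀ k : ℕ, Filter.Tendsto (fun n => (((∑ i, n i : ℕ) : ℝ)) ^ k * ‖c n‖) Filter.cofinite (nhds 0)

/-- The Schwartz space: the dense subspace of the Fock space of states whose Fock coefficients
decay faster than any polynomial. -/
def schwartz (m : ℕ) : Submodule ℂ (Fock m) where
  carrier := {c | RapidDecay (c : (Fin m → ℕ) → ℂ)}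
  zero_mem' := by
    intro k
    simpa using tendsto_const_nhds
  add_mem' := by
    intro a b ha hb k
    have h := (ha k).add (hb k)
    rw [add_zero] at h
    refine squeeze_zero (fun n => mul_nonneg (pow_nonneg (Nat.cast_nonneg _) k)
      (norm_nonneg ((a + b : Fock m) n))) (fun n => ?_) h
    rw [← mul_add]
    exact mul_le_mul_of_nonneg_left (norm_add_le (a n) (b n)) (pow_nonneg (Nat.cast_nonneg _) k)
  smul_mem' := by
    intro z a ha k
    have h := (ha k).const_mul ‖z‖
    rw [mul_zero] at h
    refine h.congr (fun n => ?_)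
    simp only [lp.coeFn_smul, Pi.smul_apply, norm_smul]
    ring

theorem sum_add_single {m : ℕ} (n : Fin m → ℕ) (j : Fin m) :
    ∑ i, (n + Pi.single j 1 : Fin m → ℕ) i = ∑ i, n i + 1 := by
  simp [Finset.sum_add_distrib]

theorem RapidDecay.tendsto_shift {m : ℕ} {c : (Fin m → ℕ) → ℂ} (hc : RapidDecay c) (k : ℕ) :
    Filter.Tendsto (fun n => (((∑ i, n i : ℕ) : ℝ) + 1) ^ k * ‖c n‖) Filter.cofinite
      (nhds 0) := by
  have h := ((hc k).add (hc 0)).const_mul ((2 : ℝ) ^ k)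
  simp only [add_zero, mul_zero] at h
  refine squeeze_zero (fun n => by positivity) (fun n => ?_) h
  rw [← add_mul, ← mul_assoc]
  refine mul_le_mul_of_nonneg_right ?_ (norm_nonneg _)
  have hx : (0 : ℝ) ≤ ((∑ i, n i : ℕ) : ℝ) := Nat.cast_nonneg _
  generalize ((∑ i, n i : ℕ) : ℝ) = x at hx
  have h1 := add_pow_le hx zero_le_one k
  refine h1.trans ?_
  rw [one_pow, pow_zero]
  exact mul_le_mul_of_nonneg_right
    (pow_le_pow_right₀ one_le_two (Nat.sub_le k 1)) (by positivity)

theorem summable_prod_inv_sq (m : ℕ) :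
    Summable (fun n : Fin m → ℕ => ∏ i, (1 / ((n i : ℝ) + 1) ^ 2)) := by
  induction m with
  | zero => exact Summable.of_finite
  | succ m ih =>
    have h1 : Summable (fun x : ℕ => 1 / ((x : ℝ) + 1) ^ 2) := by
      have := (summable_nat_add_iff 1).2 (Real.summable_one_div_nat_pow.2 one_lt_two)
      simpa using this
    have h2 := h1.mul_of_nonneg ih (fun x => by positivity)
      (fun n => Finset.prod_nonneg fun i _ => by positivity)
    rw [← (Fin.consEquiv (fun _ : Fin (m + 1) => ℕ)).summable_iff]
    refine h2.congr (fun x => ?_)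
    simp [Fin.prod_univ_succ, Fin.consEquiv, mul_comm]

theorem RapidDecay.memℓp {m : ℕ} {c : (Fin m → ℕ) → ℂ} (hc : RapidDecay c) : Memℓp c 2 := by
  rw [memℓp_gen_iff (by norm_num)]
  simp only [ENNReal.toReal_ofNat, Real.rpow_ofNat]
  have h0 : ∀ᶠ n in Filter.cofinite, (((∑ i, n i : ℕ) : ℝ) + 1) ^ m * ‖c n‖ < 1 :=
    (hc.tendsto_shift m).eventually_lt_const zero_lt_one
  refine Summable.of_norm_bounded_eventually (summable_prod_inv_sq m) ?_
  filter_upwards [h0] with n hn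
  rw [Real.norm_of_nonneg (by positivity)]
  have hp : 0 < ∏ i, ((n i : ℝ) + 1) := Finset.prod_pos fun i _ => by positivity
  have hle : ∏ i, ((n i : ℝ) + 1) ≤ (((∑ i, n i : ℕ) : ℝ) + 1) ^ m := by
    have : ∏ i, ((n i : ℝ) + 1) ≤ ∏ _i : Fin m, (((∑ i, n i : ℕ) : ℝ) + 1) := by
      refine Finset.prod_le_prod (fun i _ => by positivity) (fun i _ => ?_)
      have : n i ≤ ∑ i, n i := Finset.single_le_sum (f := n) (fun _ _ => Nat.zero_le _)
        (Finset.mem_univ i)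
      exact_mod_cast Nat.succ_le_succ this
    simpa using this
  have h1 : (∏ i, ((n i : ℝ) + 1)) * ‖c n‖ ≤ 1 :=
    (mul_le_mul_of_nonneg_right hle (norm_nonneg _)).trans hn.le
  rw [Finset.prod_div_distrib, Finset.prod_const_one, Finset.prod_pow,
    le_div_iff₀ (by positivity), mul_comm, ← mul_pow]
  exact pow_le_one₀ (by positivity) h1

theorem RapidDecay.lower {m : ℕ} {c : (Fin m → ℕ) → ℂ} (hc : RapidDecay c) (j : Fin m) :
    RapidDecay (fun n => (Real.sqrt (n j + 1) : ℂ) * c (n + Pi.single j 1)) := by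
  intro k
  have hinj : Function.Injective (fun n : Fin m → ℕ => n + Pi.single j 1) :=
    add_left_injective _
  refine squeeze_zero (fun n => by positivity) (fun n => ?_)
    ((hc (k + 1)).comp hinj.tendsto_cofinite)
  simp only [Function.comp, sum_add_single, norm_mul, Complex.norm_real]
  rw [← mul_assoc]
  refine mul_le_mul_of_nonneg_right ?_ (norm_nonneg _)
  rw [pow_succ, Real.norm_of_nonneg (Real.sqrt_nonneg _)]
  have hj : n j ≤ ∑ i, n i := Finset.single_le_sum (f := n) (fun _ _ => Nat.zero_le _)
    (Finset.mem_univ j)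
  have hj' : (n j : ℝ) ≤ ((∑ i, n i : ℕ) : ℝ) := by exact_mod_cast hj
  have hs : Real.sqrt (n j + 1) ≤ (n j : ℝ) + 1 := by
    rw [Real.sqrt_le_left (by positivity)]
    nlinarith [(Nat.cast_nonneg (n j) : (0 : ℝ) ≤ n j)]
  have hx : (0 : ℝ) ≤ ((∑ i, n i : ℕ) : ℝ) := Nat.cast_nonneg _
  rw [Nat.cast_add, Nat.cast_one]
  refine mul_le_mul (pow_le_pow_left₀ hx (by linarith) k) (by linarith)
    (Real.sqrt_nonneg _) (by positivity)

theorem RapidDecay.raise {m : ℕ} {c : (Fin m → ℕ) → ℂ} (hc : RapidDecay c) (j : Fin m) :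
    RapidDecay (fun n => (Real.sqrt (n j) : ℂ) * c (n - Pi.single j 1)) := by
  intro k
  have hfin : Filter.Tendsto (fun n : Fin m → ℕ => n - Pi.single j 1)
      Filter.cofinite Filter.cofinite := by
    refine Filter.Tendsto.cofinite_of_finite_preimage_singleton fun l => ?_
    refine (Set.finite_Iic (l + Pi.single j 1)).subset fun n hn => ?_
    have hn' : n - Pi.single j 1 = l := hn
    intro i
    have := congrFun hn' i
    simp only [Pi.sub_apply] at this
    simp only [Pi.add_apply]
    omega
  refine squeeze_zero (fun n => by positivity) (fun n => ?_)
    ((hc.tendsto_shift (k + 1)).comp hfin)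
  simp only [Function.comp, norm_mul, Complex.norm_real]
  rw [← mul_assoc]
  refine mul_le_mul_of_nonneg_right ?_ (norm_nonneg _)
  rw [pow_succ, Real.norm_of_nonneg (Real.sqrt_nonneg _)]
  rcases Nat.eq_zero_or_pos (n j) with h | h
  · rw [h, Nat.cast_zero, Real.sqrt_zero, mul_zero]
    positivity
  · have hn : n = (n - Pi.single j 1) + Pi.single j 1 := by
      funext i
      by_cases hi : i = j
      · subst hi
        simp
        omega
      · simp [hi]
    have hsum : ∑ i, n i = ∑ i, (n - Pi.single j 1 : Fin m → ℕ) i + 1 := by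
      conv_lhs => rw [hn]
      exact sum_add_single _ j
    have hj : n j ≤ ∑ i, n i := Finset.single_le_sum (f := n) (fun _ _ => Nat.zero_le _)
      (Finset.mem_univ j)
    have hj' : (n j : ℝ) ≤ ((∑ i, n i : ℕ) : ℝ) := by exact_mod_cast hj
    have h1 : (1 : ℝ) ≤ n j := by exact_mod_cast h
    have hs : Real.sqrt (n j) ≤ (n j : ℝ) := by
      rw [Real.sqrt_le_left (by positivity)]
      nlinarith
    have hsum' : ((∑ i, n i : ℕ) : ℝ)
        = ((∑ i, (n - Pi.single j 1 : Fin m → ℕ) i : ℕ) : ℝ) + 1 := by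
      exact_mod_cast hsum
    rw [← hsum']
    exact mul_le_mul_of_nonneg_left (hs.trans hj') (by positivity)

/-- The annihilation operator of mode `j` on the Schwartz space: the linear operator with
`a_j |n + e_j⟩ = √(n_j + 1) |n⟩`, and `a_j |n⟩ = 0` if `n_j = 0`. -/
noncomputable def annihilation {m : ℕ} (j : Fin m) : Module.End ℂ (schwartz m) where
  toFun x := ⟨⟨fun n => (Real.sqrt (n j + 1) : ℂ) * (x : Fock m) (n + Pi.single j 1),
    (RapidDecay.lower x.2 j).memℓp⟩, RapidDecay.lower x.2 j⟩
  map_add' x y := by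
    ext n
    exact mul_add _ _ _
  map_smul' z x := by
    ext n
    exact mul_left_comm _ _ _

/-- The creation operator of mode `j` on the Schwartz space: the linear operator with
`a_j† |n⟩ = √(n_j + 1) |n + e_j⟩`. (In the formula for the coefficients below, the square root
vanishes if `n_j = 0`, so that the truncated subtraction has no effect.) -/
noncomputable def creation {m : ℕ} (j : Fin m) : Module.End ℂ (schwartz m) where
  toFun x := ⟨⟨fun n => (Real.sqrt (n j) : ℂ) * (x : Fock m) (n - Pi.single j 1),
    (RapidDecay.raise x.2 j).memℓp⟩, RapidDecay.raise x.2 j⟩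
  map_add' x y := by
    ext n
    exact mul_add _ _ _
  map_smul' z x := by
    ext n
    exact mul_left_comm _ _ _

/-- The position operator `q_j = (a_j + a_j†) / √2`. -/
noncomputable def position {m : ℕ} (j : Fin m) : Module.End ℂ (schwartz m) :=
  (1 / (Real.sqrt 2 : ℂ)) • (annihilation j + creation j)

/-- The momentum operator `p_j = (a_j - a_j†) / (i √2)`. -/
noncomputable def momentum {m : ℕ} (j : Fin m) : Module.End ℂ (schwartz m) :=
  (1 / (Complex.I * (Real.sqrt 2 : ℂ))) • (annihilation j - creation j)

/-- Polynomials in `2 m` noncommuting variables `q_1, …, q_m` (`Sum.inl j`) and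
`p_1, …, p_m` (`Sum.inr j`). -/
abbrev QPPolynomial (m : ℕ) : Type := FreeAlgebra ℂ (Fin m ⊕ Fin m)

/-- The operator `P(q_1, p_1, …, q_m, p_m)` on the Schwartz space. -/
noncomputable def QPPolynomial.evalQP {m : ℕ} (P : QPPolynomial m) :
    Module.End ℂ (schwartz m) :=
  FreeAlgebra.lift ℂ (Sum.elim position momentum) P

/-- The operator `P(q_1, p_1, …, q_m, p_m)` as an unbounded operator on the Fock space, whose
domain is the Schwartz space. -/
noncomputable def QPPolynomial.toOperator {m : ℕ} (P : QPPolynomial m) :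
    Fock m →ₗ.[ℂ] Fock m where
  domain := schwartz m
  toFun := (schwartz m).subtype ∘ₗ P.evalQP

/-- An operator defined on a subspace of the Fock space is Hermitian (symmetric) if
`⟪A x, y⟫ = ⟪x, A y⟫` for all `x`, `y` in its domain. -/
def IsHermitianOperator {m : ℕ} (A : Fock m →ₗ.[ℂ] Fock m) : Prop :=
  A.IsFormalAdjoint A

/-- `φ` solves, on the time interval `[0, T]`, the Schrödinger equation `i dφ/dt = A φ` with
initial state `φ₀`; the derivative is taken in the norm of the Fock space, and is one-sided at
the end points. -/
def IsSchrodingerSolution {m : ℕ} (A : Fock m →ₗ.[ℂ] Fock m) (φ₀ : Fock m) (T : ℝ)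
    (φ : ℝ → Fock m) : Prop :=
  φ 0 = φ₀ ∧ ∀ t ∈ Set.Icc 0 T, ∃ v : A.domain, (v : Fock m) = φ t ∧
    HasDerivWithinAt φ (-Complex.I • A v) (Set.Icc 0 T) t

/-- The absolute value `|A| = √(A† A)` of a bounded operator on a Hilbert space. -/
noncomputable def operatorAbs {H : Type*} [NormedAddCommGroup H] [InnerProductSpace ℂ H]
    [CompleteSpace H] (A : H →L[ℂ] H) : H →L[ℂ] H :=
  CFC.abs A

/-- The trace norm `‖A‖₁ = Tr |A|`, where `|A| = √(A† A)`, with values in `[0, ∞]`; the trace is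
computed in the Fock basis. -/
noncomputable def traceNorm {m : ℕ} (A : Fock m →L[ℂ] Fock m) : ℝ≥0∞ :=
  ∑' n : Fin m → ℕ, ENNReal.ofReal (⟪fockState n, operatorAbs A (fockState n)⟫_ℂ).re

/-- The trace distance `D(ρ, σ) = ‖ρ - σ‖₁ / 2`. -/
noncomputable def traceDistance {m : ℕ} (ρ σ : Fock m →L[ℂ] Fock m) : ℝ≥0∞ :=
  traceNorm (ρ - σ) / 2

/-- The density operator `|ψ⟩⟨ψ|`. -/
noncomputable def pureState {m : ℕ} (ψ : Fock m) : Fock m →L[ℂ] Fock m :=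
  InnerProductSpace.rankOne ℂ ψ ψ

/-! Finite superpositions of Fock states are dense, so the target may be replaced by a unit vector
`y` with at most `N` particles (`exists_truncation`). Put `v = |0⟩ - y`. Because `|0⟩` and `y` have
equal norm, a complex reflection `exp(-iθ |v⟩⟨v| / ‖v‖²)` carries one to the other (`exists_phase`),
so a multiple of `|v⟩⟨v|` would serve as Hamiltonian.

That operator need not be polynomial, but only its action on vectors with at most `N` particles
matters, since the trajectory stays in the span of `|0⟩` and `v`. Write `v = C|0⟩` with `C` a
polynomial in creation operators; then `|v⟩⟨v| = C |0⟩⟨0| C†`. On at most `N` particles the vacuum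
projector agrees with `∏_{k=1}^N (1 - n̂/k)`, `n̂` the total number operator, and `C†` does not
raise the particle number. The resulting Hermitian polynomial is the one in
`exists_rankOne_hamiltonian`.

The explicit trajectory solves the equation (`exists_hamiltonian_evolution`), symmetry alone forces
uniqueness (`IsSchrodingerSolution.eqOn`), and trace distance is bounded by norm distance
(`traceDistance_pureState_le`). -/

/-! ### Formal adjoints on the Schwartz space -/

theorem inner_annihilation_left {m : ℕ} (j : Fin m) (x y : schwartz m) :
    ⟪(annihilation j x : Fock m), (y : Fock m)⟫_ℂ
      = ⟪(x : Fock m), (creation j y : Fock m)⟫_ℂ := by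
  rw [lp.inner_eq_tsum, lp.inner_eq_tsum]
  have hinj : Function.Injective (fun n : Fin m → ℕ => n + Pi.single j 1) :=
    add_left_injective _
  rw [← hinj.tsum_eq (f := fun n => ⟪(x : Fock m) n, (creation j y : Fock m) n⟫_ℂ)]
  · refine tsum_congr fun n => ?_
    change ⟪(Real.sqrt (n j + 1) : ℂ) * (x : Fock m) (n + Pi.single j 1), (y : Fock m) n⟫_ℂ
      = ⟪(x : Fock m) (n + Pi.single j 1), (Real.sqrt ((n + Pi.single j 1 : Fin m → ℕ) j : ℕ) : ℂ)
        * (y : Fock m) (n + Pi.single j 1 - Pi.single j 1)⟫_ℂ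
    rw [add_tsub_cancel_right]
    simp only [RCLike.inner_apply, map_mul, Complex.conj_ofReal, Pi.add_apply, Pi.single_eq_same,
      Nat.cast_add, Nat.cast_one]
    ring
  -- Indices missed by the shift have `n j = 0`, where the factor `√(n j)` vanishes.
  · intro n hn
    rcases Nat.eq_zero_or_pos (n j) with h | h
    · refine absurd ?_ hn
      change ⟪(x : Fock m) n, (Real.sqrt (n j : ℕ) : ℂ) * _⟫_ℂ = 0
      simp [h]
    · refine ⟨n - Pi.single j 1, tsub_add_cancel_of_le fun i => ?_⟩
      by_cases hi : i = j
      · subst hi; simpa [Nat.one_le_iff_ne_zero, Nat.pos_iff_ne_zero] using h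
      · simp [hi]

/-- `X` and `Y` are formal adjoints of each other on the Schwartz space. -/
def IsAdjointOn {m : ℕ} (X Y : Module.End ℂ (schwartz m)) : Prop :=
  ∀ x y : schwartz m, ⟪(X x : Fock m), (y : Fock m)⟫_ℂ = ⟪(x : Fock m), (Y y : Fock m)⟫_ℂ

namespace IsAdjointOn

variable {m : ℕ} {X Y X' Y' : Module.End ℂ (schwartz m)}

theorem symm (h : IsAdjointOn X Y) : IsAdjointOn Y X := fun x y => by
  rw [← inner_conj_symm, ← h, inner_conj_symm]

theorem one : IsAdjointOn (1 : Module.End ℂ (schwartz m)) 1 := fun _ _ => rfl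

theorem zero : IsAdjointOn (0 : Module.End ℂ (schwartz m)) 0 := fun x y => by simp

theorem mul (h : IsAdjointOn X Y) (h' : IsAdjointOn X' Y') : IsAdjointOn (X * X') (Y' * Y) :=
  fun x y => by rw [Module.End.mul_apply, h, h', Module.End.mul_apply]

theorem add (h : IsAdjointOn X Y) (h' : IsAdjointOn X' Y') : IsAdjointOn (X + X') (Y + Y') :=
  fun x y => by
    change ⟪(X x : Fock m) + (X' x : Fock m), (y : Fock m)⟫_ℂ
      = ⟪(x : Fock m), (Y y : Fock m) + (Y' y : Fock m)⟫_ℂ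
    rw [inner_add_left, inner_add_right, h, h']

theorem smul (h : IsAdjointOn X Y) (c : ℂ) : IsAdjointOn (c • X) (starRingEnd ℂ c • Y) :=
  fun x y => by
    change ⟪c • (X x : Fock m), (y : Fock m)⟫_ℂ
      = ⟪(x : Fock m), starRingEnd ℂ c • (Y y : Fock m)⟫_ℂ
    rw [inner_smul_left, inner_smul_right, h]

end IsAdjointOn

/-! ### Polynomial operators and the vacuum filter -/

/-- The algebra of operators that are polynomials in the positions and momenta. -/
noncomputable def qpAlgebra (m : ℕ) : Subalgebra ℂ (Module.End ℂ (schwartz m)) :=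
  (FreeAlgebra.lift ℂ (Sum.elim (position (m := m)) momentum)).range

theorem position_mem {m : ℕ} (j : Fin m) : position j ∈ qpAlgebra m :=
  ⟨FreeAlgebra.ι ℂ (Sum.inl j), by simp⟩

theorem momentum_mem {m : ℕ} (j : Fin m) : momentum j ∈ qpAlgebra m :=
  ⟨FreeAlgebra.ι ℂ (Sum.inr j), by simp⟩

theorem sqrt_two_mul_self : (Real.sqrt 2 : ℂ) * (Real.sqrt 2 : ℂ) = 2 := by
  rw [← Complex.ofReal_mul, Real.mul_self_sqrt (by norm_num)]; norm_num

theorem annihilation_mem {m : ℕ} (j : Fin m) : annihilation j ∈ qpAlgebra m := by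
  have h : annihilation j = (1 / (Real.sqrt 2 : ℂ)) • (position j + Complex.I • momentum j) := by
    have h2 : (Real.sqrt 2 : ℂ) ≠ 0 := by simp
    have e1 : (1 / (Real.sqrt 2 : ℂ)) * (1 / (Real.sqrt 2 : ℂ)) = 1 / 2 := by
      rw [div_mul_div_comm, sqrt_two_mul_self, one_mul]
    have e2 : (1 / (Real.sqrt 2 : ℂ)) * (Complex.I * (1 / (Complex.I * (Real.sqrt 2 : ℂ))))
        = 1 / 2 := by
      rw [← e1]; field_simp [Complex.I_ne_zero]
    rw [position, momentum, smul_add, smul_smul, smul_smul, smul_smul, mul_assoc, e1, e2]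
    module
  rw [h]
  exact Subalgebra.smul_mem _ (add_mem (position_mem j)
    (Subalgebra.smul_mem _ (momentum_mem j) _)) _

theorem creation_mem {m : ℕ} (j : Fin m) : creation j ∈ qpAlgebra m := by
  have h : creation j = (Real.sqrt 2 : ℂ) • position j - annihilation j := by
    have h2 : (Real.sqrt 2 : ℂ) ≠ 0 := by simp
    rw [position, smul_smul, mul_one_div_cancel h2]
    module
  rw [h]
  exact sub_mem (Subalgebra.smul_mem _ (position_mem j) _) (annihilation_mem j)

/-- The total number operator `∑ⱼ aⱼ† aⱼ`. -/
noncomputable def totalNumber (m : ℕ) : Module.End ℂ (schwartz m) :=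
  ∑ j, creation j * annihilation j

theorem totalNumber_mem (m : ℕ) : totalNumber m ∈ qpAlgebra m :=
  sum_mem fun j _ => mul_mem (creation_mem j) (annihilation_mem j)

theorem creation_annihilation_apply {m : ℕ} (j : Fin m) (x : schwartz m) (n : Fin m → ℕ) :
    ((creation j * annihilation j) x : Fock m) n = (n j : ℂ) * (x : Fock m) n := by
  change (Real.sqrt (n j : ℕ) : ℂ) * ((Real.sqrt (((n - Pi.single j 1 : Fin m → ℕ) j : ℕ) + 1) : ℂ)
    * (x : Fock m) (n - Pi.single j 1 + Pi.single j 1)) = _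
  rcases Nat.eq_zero_or_pos (n j) with h | h
  · simp [h]
  · have h1 : n - Pi.single j 1 + Pi.single j 1 = n := tsub_add_cancel_of_le fun i => by
      by_cases hi : i = j
      · subst hi; simpa [Nat.one_le_iff_ne_zero, Nat.pos_iff_ne_zero] using h
      · simp [hi]
    have h2 : (((n - Pi.single j 1 : Fin m → ℕ) j : ℕ) : ℝ) + 1 = n j := by
      have := congrFun h1 j
      simp only [Pi.add_apply, Pi.single_eq_same] at this
      exact_mod_cast this
    rw [h1, h2, ← mul_assoc, ← Complex.ofReal_mul, Real.mul_self_sqrt (Nat.cast_nonneg _)]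
    simp

theorem totalNumber_apply {m : ℕ} (x : schwartz m) (n : Fin m → ℕ) :
    (totalNumber m x : Fock m) n = ((∑ i, n i : ℕ) : ℂ) * (x : Fock m) n := by
  rw [totalNumber, LinearMap.sum_apply, AddSubmonoidClass.coe_finsetSum, lp.coeFn_sum,
    Finset.sum_apply]
  simp only [creation_annihilation_apply]
  rw [← Finset.sum_mul, Nat.cast_sum]

/-- A polynomial substitute for the vacuum projector, valid up to `N` particles; its behaviour
beyond `N` is irrelevant. Real eigenvalues make it symmetric. -/
theorem exists_vacuumFilter (m N : ℕ) : ∃ Q ∈ qpAlgebra m, ∃ q : ℕ → ℝ,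
    (∀ (x : schwartz m) n, (Q x : Fock m) n = (q (∑ i, n i) : ℂ) * (x : Fock m) n) ∧
      q 0 = 1 ∧ ∀ s, 1 ≤ s → s ≤ N → q s = 0 := by
  induction N with
  | zero => exact ⟨1, one_mem _, fun _ => 1, by simp, rfl, by intros; omega⟩
  | succ N ih =>
    obtain ⟨Q, hQ, q, h, h0, h1⟩ := ih
    refine ⟨(1 - (1 / ((N : ℂ) + 1)) • totalNumber m) * Q,
      mul_mem (sub_mem (one_mem _) (Subalgebra.smul_mem _ (totalNumber_mem m) _)) hQ,
      fun s => (1 - 1 / ((N : ℝ) + 1) * s) * q s, fun x n => ?_, by simp [h0], fun s hs hs' => ?_⟩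
    · rw [Module.End.mul_apply, LinearMap.sub_apply, LinearMap.smul_apply, Module.End.one_apply]
      change (Q x : Fock m) n - (1 / ((N : ℂ) + 1)) * (totalNumber m (Q x) : Fock m) n = _
      rw [totalNumber_apply, h]
      push_cast
      ring
    · rcases Nat.lt_or_ge N s with hN | hN
      · obtain rfl : s = N + 1 := by omega
        have : ((N : ℝ) + 1) ≠ 0 := by positivity
        push_cast
        rw [one_div_mul_cancel this, sub_self, zero_mul]
      · simp [h1 s hs hN]

/-! ### Fock states generated from the vacuum -/

theorem rapidDecay_fockState {m : ℕ} (n : Fin m → ℕ) : fockState n ∈ schwartz m := by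
  intro k
  refine tendsto_const_nhds.congr' ?_
  filter_upwards [(Set.finite_singleton n).compl_mem_cofinite] with l hl
  have : l ≠ n := hl
  simp [fockState, lp.single_apply, this]

/-- The Fock basis vector as an element of the Schwartz space. -/
noncomputable def schwartzFock {m : ℕ} (n : Fin m → ℕ) : schwartz m :=
  ⟨fockState n, rapidDecay_fockState n⟩

theorem fockState_apply {m : ℕ} (n l : Fin m → ℕ) :
    (fockState n) l = if l = n then (1 : ℂ) else 0 := by
  simp [fockState, lp.single_apply, Pi.single_apply]

theorem inner_fockState_left {m : ℕ} (n : Fin m → ℕ) (x : Fock m) :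
    ⟪fockState n, x⟫_ℂ = x n := by
  rw [fockState, lp.inner_single_left]
  simp

theorem creation_schwartzFock {m : ℕ} (j : Fin m) (n : Fin m → ℕ) :
    creation j (schwartzFock n)
      = (Real.sqrt (n j + 1) : ℂ) • schwartzFock (n + Pi.single j 1) := by
  ext l
  change (Real.sqrt (l j : ℕ) : ℂ) * (fockState n) (l - Pi.single j 1)
    = (Real.sqrt (n j + 1) : ℂ) * (fockState (n + Pi.single j 1)) l
  rw [fockState_apply, fockState_apply]
  by_cases h : l = n + Pi.single j 1
  · subst h
    simp
  · rw [if_neg h]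
    rcases Nat.eq_zero_or_pos (l j) with h0 | h0
    · simp [h0]
    · rw [if_neg, mul_zero, mul_zero]
      intro h1
      refine h ?_
      rw [← h1, tsub_add_cancel_of_le]
      intro i
      by_cases hi : i = j
      · subst hi; simpa [Nat.one_le_iff_ne_zero, Nat.pos_iff_ne_zero] using h0
      · simp [hi]

/-- The vectors of the Schwartz space with at most `N` particles. -/
def particleBound (m N : ℕ) : Submodule ℂ (schwartz m) where
  carrier := {x | ∀ n, N < ∑ i, n i → (x : Fock m) n = 0}
  zero_mem' _ _ := rfl
  add_mem' {x y} hx hy n hn := by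
    change (x : Fock m) n + (y : Fock m) n = 0
    rw [hx n hn, hy n hn, add_zero]
  smul_mem' z x hx n hn := by
    change z * (x : Fock m) n = 0
    rw [hx n hn, mul_zero]

theorem annihilation_particleBound {m N : ℕ} (j : Fin m) {x : schwartz m}
    (hx : x ∈ particleBound m N) : annihilation j x ∈ particleBound m N := by
  intro n hn
  change (Real.sqrt (n j + 1) : ℂ) * (x : Fock m) (n + Pi.single j 1) = 0
  rw [hx _ (by rw [sum_add_single]; omega), mul_zero]

/-- The vectors obtained from the vacuum by an operator polynomial in the positions and momenta
whose formal adjoint is of the same kind and does not increase the number of particles. -/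
noncomputable def reachable (m : ℕ) : Submodule ℂ (schwartz m) where
  carrier := {v | ∃ C ∈ qpAlgebra m, ∃ C' ∈ qpAlgebra m, IsAdjointOn C C' ∧
    C (schwartzFock 0) = v ∧ ∀ N, ∀ x ∈ particleBound m N, C' x ∈ particleBound m N}
  zero_mem' := ⟨0, zero_mem _, 0, zero_mem _, .zero, rfl, fun N _ _ => zero_mem _⟩
  add_mem' := by
    rintro _ _ ⟨C, hC, C', hC', h, rfl, hb⟩ ⟨D, hD, D', hD', k, rfl, kb⟩
    exact ⟨C + D, add_mem hC hD, C' + D', add_mem hC' hD', h.add k, rfl,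
      fun N x hx => add_mem (hb N x hx) (kb N x hx)⟩
  smul_mem' := by
    rintro z _ ⟨C, hC, C', hC', h, rfl, hb⟩
    exact ⟨z • C, Subalgebra.smul_mem _ hC _, _, Subalgebra.smul_mem _ hC' _, h.smul z, rfl,
      fun N x hx => Submodule.smul_mem _ _ (hb N x hx)⟩

theorem creation_reachable {m : ℕ} (j : Fin m) {v : schwartz m} (hv : v ∈ reachable m) :
    creation j v ∈ reachable m := by
  obtain ⟨C, hC, C', hC', h, rfl, hb⟩ := hv
  exact ⟨creation j * C, mul_mem (creation_mem j) hC, C' * annihilation j,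
    mul_mem hC' (annihilation_mem j),
    IsAdjointOn.mul (IsAdjointOn.symm (inner_annihilation_left j)) h, rfl,
    fun N x hx => hb N _ (annihilation_particleBound j hx)⟩

/-- Induction on the particle number: remove a particle from an occupied mode, recreate it, and
divide by the nonzero factor. -/
theorem schwartzFock_reachable {m : ℕ} (n : Fin m → ℕ) : schwartzFock n ∈ reachable m := by
  induction hs : ∑ i, n i generalizing n with
  | zero =>
    obtain rfl : n = 0 := by
      funext i
      exact (Finset.sum_eq_zero_iff.1 hs) i (Finset.mem_univ i)
    exact ⟨1, one_mem _, 1, one_mem _, .one, rfl, fun N x hx => hx⟩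
  | succ s ih =>
    obtain ⟨j, -, hj⟩ := Finset.exists_ne_zero_of_sum_ne_zero (by omega : ∑ i, n i ≠ 0)
    have h1 : n - Pi.single j 1 + Pi.single j 1 = n := tsub_add_cancel_of_le fun i => by
      by_cases hi : i = j
      · subst hi; simp; omega
      · simp [hi]
    have h2 := sum_add_single (n - Pi.single j 1) j
    rw [h1, hs] at h2
    have h3 := creation_reachable j (ih (n - Pi.single j 1) (by omega))
    rw [creation_schwartzFock, h1] at h3
    refine (Submodule.smul_mem_iff _ ?_).1 h3
    rw [Complex.ofReal_ne_zero, Real.sqrt_ne_zero']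
    positivity

/-! ### Polynomial Hamiltonians of rank one on bounded particle number -/

theorem exists_rankOne_hamiltonian {m N : ℕ} {v : schwartz m} (hv : v ∈ reachable m) (κ : ℝ) :
    ∃ P : QPPolynomial m, IsHermitianOperator P.toOperator ∧ ∀ x ∈ particleBound m N,
      P.evalQP x = ((κ : ℂ) * ⟪(v : Fock m), (x : Fock m)⟫_ℂ) • v := by
  obtain ⟨C, hC, C', hC', h, rfl, hb⟩ := hv
  obtain ⟨Q, hQ, q, hq, q0, q1⟩ := exists_vacuumFilter m N
  have hQa : IsAdjointOn Q Q := fun x y => by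
    rw [lp.inner_eq_tsum, lp.inner_eq_tsum]
    refine tsum_congr fun n => ?_
    rw [hq, hq]
    simp only [RCLike.inner_apply, map_mul, Complex.conj_ofReal]
    ring
  obtain ⟨P : QPPolynomial m, hP : P.evalQP = (κ : ℂ) • (C * Q * C')⟩ :=
    Subalgebra.smul_mem _ (mul_mem (mul_mem hC hQ) hC') (κ : ℂ)
  refine ⟨P, fun x y => ?_, fun x hx => ?_⟩
  · have hA : IsAdjointOn P.evalQP P.evalQP := by
      have := ((h.mul hQa).mul h.symm).smul (κ : ℂ)
      rw [Complex.conj_ofReal, ← mul_assoc] at this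
      rwa [hP]
    exact hA x y
  -- `C' x` still has at most `N` particles, so the filter leaves only its vacuum coefficient `⟨0,
  -- C' x⟩ = ⟨C 0, x⟩`.
  · have h1 : Q (C' x) = ⟪(C (schwartzFock 0) : Fock m), (x : Fock m)⟫_ℂ • schwartzFock 0 := by
      rw [h]
      change _ = ⟪fockState 0, (C' x : Fock m)⟫_ℂ • _
      rw [inner_fockState_left]
      ext n
      rw [hq]
      change _ = (C' x : Fock m) 0 * (fockState 0) n
      rw [fockState_apply]
      by_cases hn : n = 0
      · subst hn
        simp [q0]
      · rw [if_neg hn, mul_zero]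
        rcases Nat.lt_or_ge N (∑ i, n i) with h2 | h2
        · rw [hb N x hx n h2, mul_zero]
        · rw [q1 _ _ h2, Complex.ofReal_zero, zero_mul]
          rw [Nat.one_le_iff_ne_zero]
          intro h3
          exact hn (funext fun i => (Finset.sum_eq_zero_iff.1 h3) i (Finset.mem_univ i))
    rw [hP, LinearMap.smul_apply, Module.End.mul_apply, Module.End.mul_apply, h1, map_smul,
      smul_smul]

/-! ### Uniqueness of Schrödinger evolution -/

theorem IsSchrodingerSolution.mono {m : ℕ} {A B : Fock m →ₗ.[ℂ] Fock m} {φ₀ : Fock m} {T : ℝ}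
    {φ : ℝ → Fock m} (h : IsSchrodingerSolution A φ₀ T φ) (hAB : A ≤ B) :
    IsSchrodingerSolution B φ₀ T φ := by
  refine ⟨h.1, fun t ht => ?_⟩
  obtain ⟨v, hv, hd⟩ := h.2 t ht
  refine ⟨⟨v, hAB.1 v.2⟩, hv, ?_⟩
  rwa [← hAB.2 (x := v) rfl]

/-- The difference of two solutions has constant norm, because symmetry cancels the two terms in the
derivative of its square. Self-adjointness is not needed, so any symmetric extension is covered. -/
theorem IsSchrodingerSolution.eqOn {m : ℕ} {A : Fock m →ₗ.[ℂ] Fock m} {φ₀ : Fock m} {T : ℝ}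
    {φ χ : ℝ → Fock m} (hA : IsHermitianOperator A) (hφ : IsSchrodingerSolution A φ₀ T φ)
    (hχ : IsSchrodingerSolution A φ₀ T χ) : Set.EqOn χ φ (Set.Icc 0 T) := by
  have key : ∀ t ∈ Set.Icc 0 T, HasDerivWithinAt (fun t => ⟪χ t - φ t, χ t - φ t⟫_ℂ) 0
      (Set.Icc 0 T) t := by
    intro t ht
    obtain ⟨v, hv, hdv⟩ := hφ.2 t ht
    obtain ⟨w, hw, hdw⟩ := hχ.2 t ht
    have hd := hdw.sub hdv
    refine (hd.inner ℂ hd).congr_deriv ?_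
    have h1 : χ t - φ t = ((w - v : A.domain) : Fock m) := by
      rw [Submodule.coe_sub, hw, hv]
    have h2 : -Complex.I • A w - -Complex.I • A v = -Complex.I • A (w - v) := by
      rw [← smul_sub, ← A.map_sub]
    have h3 : ⟪A (w - v), ((w - v : A.domain) : Fock m)⟫_ℂ
        = ⟪((w - v : A.domain) : Fock m), A (w - v)⟫_ℂ := hA _ _
    simp only [Pi.sub_apply]
    rw [h1, h2, inner_smul_left, inner_smul_right, h3, map_neg, Complex.conj_I]
    ring
  have hconst := constant_of_derivWithin_zero
    (fun t ht => (key t ht).differentiableWithinAt) (fun t ht =>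
      (key t (Set.Ico_subset_Icc_self ht)).derivWithin
        (uniqueDiffOn_Icc (ht.1.trans_lt ht.2) t (Set.Ico_subset_Icc_self ht)))
  intro t ht
  have h := hconst t ht
  rw [hφ.1, hχ.1, sub_self, inner_zero_left, inner_self_eq_zero, sub_eq_zero] at h
  exact h

/-! ### Steering the vacuum to a finite-particle state -/

/-- With `w = ⟪x - y, x⟫` and `r = ‖x - y‖²`, equality of norms gives `w + conj w = r`. The required
phase is therefore `1 - r / w = -conj w / w`, of modulus one. -/
theorem exists_phase {H : Type*} [NormedAddCommGroup H] [InnerProductSpace ℂ H] {x y : H}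
    (hxy : ‖x‖ = ‖y‖) (hne : x ≠ y) : ∃ θ : ℝ,
      (Complex.exp (-Complex.I * θ) - 1) * (⟪x - y, x⟫_ℂ / (‖x - y‖ : ℂ) ^ 2) = -1 := by
  have hr : (‖x - y‖ : ℂ) ^ 2 ≠ 0 :=
    pow_ne_zero 2 (Complex.ofReal_ne_zero.2 (norm_ne_zero_iff.2 (sub_ne_zero.2 hne)))
  have hxx : ⟪x, x⟫_ℂ = ⟪y, y⟫_ℂ := by
    rw [inner_self_eq_norm_sq_to_K, inner_self_eq_norm_sq_to_K, hxy]
  have hwr : ⟪x - y, x⟫_ℂ - (‖x - y‖ : ℂ) ^ 2 = -(starRingEnd ℂ) ⟪x - y, x⟫_ℂ := by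
    have : (‖x - y‖ : ℂ) ^ 2 = ⟪x - y, x - y⟫_ℂ := by
      rw [inner_self_eq_norm_sq_to_K]; rfl
    rw [this, inner_conj_symm]
    simp only [inner_sub_left, inner_sub_right]
    linear_combination hxx
  have hw : ⟪x - y, x⟫_ℂ ≠ 0 := by
    intro h
    rw [h, map_zero, neg_zero, zero_sub, neg_eq_zero] at hwr
    exact hr hwr
  have hu : ‖-(starRingEnd ℂ) ⟪x - y, x⟫_ℂ / ⟪x - y, x⟫_ℂ‖ = 1 := by
    rw [norm_div, norm_neg, RCLike.norm_conj, div_self (norm_ne_zero_iff.2 hw)]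
  obtain ⟨θ, hθ⟩ := (Complex.norm_eq_one_iff _).1 hu
  refine ⟨-θ, ?_⟩
  have hexp : -Complex.I * ((-θ : ℝ) : ℂ) = θ * Complex.I := by push_cast; ring
  rw [hexp, hθ, ← hwr]
  generalize (‖x - y‖ : ℂ) ^ 2 = r at hr
  field_simp
  ring

theorem exists_hamiltonian_evolution {m : ℕ} {T : ℝ} (hT : 0 < T) {y : schwartz m}
    (hy : y ∈ reachable m) (hy1 : ‖(y : Fock m)‖ = 1) {N : ℕ} (hN : y ∈ particleBound m N) :
    ∃ P : QPPolynomial m, IsHermitianOperator P.toOperator ∧ ∃ φ : ℝ → Fock m,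
      IsSchrodingerSolution P.toOperator (vacuum m) T φ ∧ φ T = y := by
  set x : schwartz m := schwartzFock 0 with hx
  have hx1 : ‖(x : Fock m)‖ = 1 := by
    change ‖(lp.single 2 0 (1 : ℂ) : Fock m)‖ = 1
    rw [lp.norm_single (by norm_num), norm_one]
  have hxN : x ∈ particleBound m N := by
    intro n hn
    change (fockState 0) n = 0
    rw [fockState_apply, if_neg]
    rintro rfl
    simp at hn
  -- If the target is the vacuum, `v` vanishes and the zero Hamiltonian does the job.
  by_cases hne : (x : Fock m) = y
  · have h0 : (0 : QPPolynomial m).evalQP = 0 := map_zero _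
    refine ⟨0, fun u v => ?_, fun _ => x, ⟨rfl, fun t _ => ⟨x, rfl, ?_⟩⟩, hne⟩
    · have hA : IsAdjointOn (0 : QPPolynomial m).evalQP (0 : QPPolynomial m).evalQP := by
        rw [h0]
        exact .zero
      exact hA u v
    · refine (hasDerivWithinAt_const _ _ _).congr_deriv ?_
      change 0 = -Complex.I • ((QPPolynomial.evalQP 0 x : schwartz m) : Fock m)
      simp [h0]
  obtain ⟨θ, hθ⟩ := exists_phase (hx1.trans hy1.symm) hne
  set v : schwartz m := x - y with hv
  have hvr : v ∈ reachable m := sub_mem (schwartzFock_reachable 0) hy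
  have hvN : v ∈ particleBound m N := sub_mem hxN hN
  have hr : (‖(v : Fock m)‖ : ℂ) ^ 2 ≠ 0 := by
    rw [hv, Submodule.coe_sub]
    simpa [sub_eq_zero] using hne
  change (Complex.exp (-Complex.I * θ) - 1) *
    (⟪(v : Fock m), (x : Fock m)⟫_ℂ / (‖(v : Fock m)‖ : ℂ) ^ 2) = -1 at hθ
  have hvv : ⟪(v : Fock m), (v : Fock m)⟫_ℂ = (‖(v : Fock m)‖ : ℂ) ^ 2 :=
    inner_self_eq_norm_sq_to_K _
  -- This coupling gives `v` the eigenvalue `θ / T`, hence the phase `exp(-iθ)` at time `T`.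
  obtain ⟨P, hP, hPv⟩ := exists_rankOne_hamiltonian (N := N) hvr (θ / (T * ‖(v : Fock m)‖ ^ 2))
  have hT' : (T : ℂ) ≠ 0 := by exact_mod_cast hT.ne'
  set r : ℂ := (‖(v : Fock m)‖ : ℂ) ^ 2 with hr_def
  set w : ℂ := ⟪(v : Fock m), (x : Fock m)⟫_ℂ with hw_def
  let e : ℝ → ℂ := fun t => Complex.exp (-Complex.I * (θ / T) * t)
  -- The component `(w / r) • v` of the vacuum along `v` acquires the phase `e t`; the orthogonal
  -- part is fixed.
  let φ : ℝ → schwartz m := fun t => x + ((e t - 1) * (w / r)) • v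
  refine ⟨P, hP, fun t => φ t, ⟨?_, fun t _ => ⟨φ t, rfl, ?_⟩⟩, ?_⟩
  · simp [φ, e, hx, vacuum, schwartzFock]
  · have he : HasDerivAt e (e t * (-Complex.I * (θ / T))) t := by
      have h := ((hasDerivAt_id t).ofReal_comp.const_mul (-Complex.I * (θ / T))).cexp
      simpa [e] using h
    have h1 : HasDerivAt (fun t => (φ t : Fock m))
        ((e t * (-Complex.I * (θ / T)) * (w / r)) • (v : Fock m)) t :=
      (((he.sub_const 1).mul_const (w / r)).smul_const (v : Fock m)).const_add (x : Fock m)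
    refine h1.hasDerivWithinAt.congr_deriv ?_
    change _ = -Complex.I • ((P.evalQP (φ t) : schwartz m) : Fock m)
    rw [hPv (φ t) (add_mem hxN (Submodule.smul_mem _ _ hvN)), Submodule.coe_smul, smul_smul]
    congr 1
    have h2 : ⟪(v : Fock m), (φ t : Fock m)⟫_ℂ = w + (e t - 1) * (w / r) * r := by
      simp only [φ, Submodule.coe_add, Submodule.coe_smul, inner_add_right, inner_smul_right, hvv]
      rfl
    rw [h2]
    push_cast
    rw [← hr_def]
    field_simp
    ring
  · have h3 : e T = Complex.exp (-Complex.I * θ) := by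
      simp only [e]
      rw [mul_assoc, div_mul_cancel₀ _ hT']
    change ((x + ((e T - 1) * (w / r)) • v : schwartz m) : Fock m) = y
    rw [h3, hθ, hv]
    simp

/-! ### Density of finite-particle unit vectors -/

theorem exists_truncation {m : ℕ} {ψ : Fock m} (hψ : ‖ψ‖ = 1) {ε : ℝ} (hε : 0 < ε) :
    ∃ y : schwartz m, y ∈ reachable m ∧ ‖(y : Fock m)‖ = 1 ∧ ‖ψ - y‖ ≤ ε ∧
      ∃ N, y ∈ particleBound m N := by
  classical
  let f : Finset (Fin m → ℕ) → schwartz m := fun s => ∑ n ∈ s, ψ n • schwartzFock n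
  have hf : ∀ s, (f s : Fock m) = ∑ n ∈ s, lp.single 2 n (ψ n) := by
    intro s
    simp only [f, AddSubmonoidClass.coe_finsetSum, Submodule.coe_smul]
    refine Finset.sum_congr rfl fun n _ => ?_
    change ψ n • (lp.single 2 n (1 : ℂ) : Fock m) = _
    rw [← lp.single_smul, smul_eq_mul, mul_one]
  have h1 : Filter.Tendsto (fun s => (f s : Fock m)) Filter.atTop (nhds ψ) := by
    simp only [hf]
    exact lp.hasSum_single (by norm_num) ψ
  have h2 : Filter.Tendsto (fun s => ‖(f s : Fock m)‖) Filter.atTop (nhds 1) := hψ ▸ h1.norm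
  have h3 : Filter.Tendsto (fun s => ((‖(f s : Fock m)‖ : ℂ)⁻¹) • (f s : Fock m)) Filter.atTop
      (nhds ψ) := by
    have h4 := ((Complex.continuous_ofReal.tendsto 1).comp h2).inv₀ (by simp)
    simpa using h4.smul h1
  have h5 := ((tendsto_const_nhds (x := ψ)).sub h3).norm
  rw [sub_self, norm_zero] at h5
  obtain ⟨s, hs, hs'⟩ :=
    ((h5.eventually_lt_const hε).and (h2.eventually_ne one_ne_zero)).exists
  refine ⟨((‖(f s : Fock m)‖ : ℂ)⁻¹) • f s, Submodule.smul_mem _ _ (sum_mem fun n _ =>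
    Submodule.smul_mem _ _ (schwartzFock_reachable n)), ?_, hs.le, s.sup fun n => ∑ i, n i,
    Submodule.smul_mem _ _ (sum_mem fun n hn => Submodule.smul_mem _ _ fun l hl => ?_)⟩
  · rw [Submodule.coe_smul, norm_smul, norm_inv, Complex.norm_real, norm_norm,
      inv_mul_cancel₀ hs']
  · change (fockState n) l = 0
    rw [fockState_apply, if_neg]
    rintro rfl
    exact absurd (Finset.le_sup (f := fun n : Fin m → ℕ => ∑ i, n i) hn) (not_le.2 hl)

/-! ### Trace distance of pure states -/

section PureStates

variable {m : ℕ} {ψ φ : Fock m}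

theorem pureState_sub_apply (ψ φ z : Fock m) :
    (pureState ψ - pureState φ) z = ⟪ψ, z⟫_ℂ • ψ - ⟪φ, z⟫_ℂ • φ := rfl

theorem pureState_sub_apply_left (hψ : ‖ψ‖ = 1) :
    (pureState ψ - pureState φ) ψ = ψ - ⟪φ, ψ⟫_ℂ • φ := by
  rw [pureState_sub_apply, inner_self_eq_norm_sq_to_K, hψ]
  simp

theorem pureState_sub_apply_right (hφ : ‖φ‖ = 1) :
    (pureState ψ - pureState φ) φ = ⟪ψ, φ⟫_ℂ • ψ - φ := by
  rw [pureState_sub_apply, inner_self_eq_norm_sq_to_K, hφ]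
  simp

theorem isSelfAdjoint_pureState_sub (ψ φ : Fock m) :
    IsSelfAdjoint (pureState ψ - pureState φ) := by
  rw [ContinuousLinearMap.isSelfAdjoint_iff_isSymmetric]
  intro x y
  change ⟪⟪ψ, x⟫_ℂ • ψ - ⟪φ, x⟫_ℂ • φ, y⟫_ℂ = ⟪x, ⟪ψ, y⟫_ℂ • ψ - ⟪φ, y⟫_ℂ • φ⟫_ℂ
  simp only [inner_sub_left, inner_sub_right, inner_smul_left, inner_smul_right, inner_conj_symm]
  ring

theorem inner_mul_inner_swap (ψ φ : Fock m) :
    ⟪ψ, φ⟫_ℂ * ⟪φ, ψ⟫_ℂ = (‖⟪ψ, φ⟫_ℂ‖ : ℂ) ^ 2 := by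
  rw [← inner_conj_symm φ ψ, Complex.mul_conj']

/-- The square of the difference is scalar on the span of `ψ` and `φ`, which contains its range. -/
theorem pureState_sub_cube (hψ : ‖ψ‖ = 1) (hφ : ‖φ‖ = 1) :
    (pureState ψ - pureState φ) * ((pureState ψ - pureState φ) * (pureState ψ - pureState φ))
      = ((1 - ‖⟪ψ, φ⟫_ℂ‖ ^ 2 : ℝ) : ℂ) • (pureState ψ - pureState φ) := by
  have hc := inner_mul_inner_swap ψ φ
  set A := pureState ψ - pureState φ with hA
  have h1 : A (A ψ) = ((1 - ‖⟪ψ, φ⟫_ℂ‖ ^ 2 : ℝ) : ℂ) • ψ := by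
    rw [hA, pureState_sub_apply_left hψ, map_sub, map_smul, pureState_sub_apply_left hψ,
      pureState_sub_apply_right hφ]
    push_cast
    rw [← hc]
    module
  have h2 : A (A φ) = ((1 - ‖⟪ψ, φ⟫_ℂ‖ ^ 2 : ℝ) : ℂ) • φ := by
    rw [hA, pureState_sub_apply_right hφ, map_sub, map_smul, pureState_sub_apply_left hψ,
      pureState_sub_apply_right hφ]
    push_cast
    rw [← hc]
    module
  ext1 z
  change A (A (A z)) = ((1 - ‖⟪ψ, φ⟫_ℂ‖ ^ 2 : ℝ) : ℂ) • A z
  have hz : A z = ⟪ψ, z⟫_ℂ • ψ - ⟪φ, z⟫_ℂ • φ := pureState_sub_apply ψ φ z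
  rw [hz, map_sub, map_sub, map_smul, map_smul, map_smul, map_smul, h1, h2]
  module

theorem hasSum_pureState_sub_sq (hψ : ‖ψ‖ = 1) (hφ : ‖φ‖ = 1) :
    HasSum (fun n => ⟪fockState n,
      ((pureState ψ - pureState φ) * (pureState ψ - pureState φ)) (fockState n)⟫_ℂ)
      ((2 * (1 - ‖⟪ψ, φ⟫_ℂ‖ ^ 2) : ℝ) : ℂ) := by
  have hs : ∀ a b : Fock m, HasSum (fun n => b n * starRingEnd ℂ (a n)) ⟪a, b⟫_ℂ :=
    fun a b => lp.hasSum_inner a b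
  have h := ((hs ψ ψ).add (hs φ φ)).sub
    (((hs ψ φ).mul_left ⟪φ, ψ⟫_ℂ).add ((hs φ ψ).mul_left ⟪ψ, φ⟫_ℂ))
  have hval : ⟪ψ, ψ⟫_ℂ + ⟪φ, φ⟫_ℂ - (⟪φ, ψ⟫_ℂ * ⟪ψ, φ⟫_ℂ + ⟪ψ, φ⟫_ℂ * ⟪φ, ψ⟫_ℂ)
      = ((2 * (1 - ‖⟪ψ, φ⟫_ℂ‖ ^ 2) : ℝ) : ℂ) := by
    rw [mul_comm ⟪φ, ψ⟫_ℂ, inner_mul_inner_swap, inner_self_eq_norm_sq_to_K,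
      inner_self_eq_norm_sq_to_K, hψ, hφ]
    push_cast
    ring
  rw [hval] at h
  refine (congrArg (HasSum · _ _) (funext fun n => ?_)).mpr h
  rw [mul_apply_eq_comp, pureState_sub_apply ψ φ (fockState n), map_sub, map_smul,
    map_smul, pureState_sub_apply_left hψ, pureState_sub_apply_right hφ, inner_fockState_left,
    ← inner_conj_symm ψ (fockState n), ← inner_conj_symm φ (fockState n),
    inner_fockState_left, inner_fockState_left]
  change starRingEnd ℂ (ψ n) * (ψ n - ⟪φ, ψ⟫_ℂ * φ n)
    - starRingEnd ℂ (φ n) * (⟪ψ, φ⟫_ℂ * ψ n - φ n) = _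
  ring

open scoped ComplexOrder in
-- With `A` the difference, `A³ = s² A` gives `(A² / s)² = A²`, and `A² / s` is nonnegative, so it
-- is the square root of `A² = A† A`.
theorem operatorAbs_pureState_sub (hψ : ‖ψ‖ = 1) (hφ : ‖φ‖ = 1) {s : ℝ} (hs : 0 < s)
    (hs2 : s ^ 2 = 1 - ‖⟪ψ, φ⟫_ℂ‖ ^ 2) :
    0 ≤ operatorAbs (pureState ψ - pureState φ) ∧ operatorAbs (pureState ψ - pureState φ)
      = (s : ℂ)⁻¹ • ((pureState ψ - pureState φ) * (pureState ψ - pureState φ)) := by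
  refine ⟨CFC.abs_nonneg _, ?_⟩
  have hsa : star (pureState ψ - pureState φ) = pureState ψ - pureState φ :=
    isSelfAdjoint_pureState_sub ψ φ
  have h3 := pureState_sub_cube hψ hφ
  rw [← hs2] at h3
  have hpos := star_mul_self_nonneg (pureState ψ - pureState φ)
  rw [operatorAbs, CFC.abs]
  rw [hsa] at hpos ⊢
  set A := pureState ψ - pureState φ
  have hs' : (s : ℂ) ≠ 0 := by exact_mod_cast hs.ne'
  refine CFC.sqrt_unique ?_ ?_
  · rw [smul_mul_smul_comm, mul_assoc, h3, mul_smul_comm, smul_smul]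
    push_cast
    rw [← mul_inv, ← sq, inv_mul_cancel₀ (pow_ne_zero 2 hs'), one_smul]
  · refine smul_nonneg ?_ hpos
    rw [← Complex.ofReal_inv]
    exact_mod_cast (inv_pos.2 hs).le

/-- `Tr |A| = Tr A² / s = 2 s`, so the distance equals `s = √(1 - |⟪ψ, φ⟫|²)`. -/
theorem traceDistance_pureState_le (hψ : ‖ψ‖ = 1) (hφ : ‖φ‖ = 1) :
    traceDistance (pureState ψ) (pureState φ) ≤ ENNReal.ofReal ‖ψ - φ‖ := by
  have hc1 : ‖⟪ψ, φ⟫_ℂ‖ ≤ 1 := by simpa [hψ, hφ] using norm_inner_le_norm (𝕜 := ℂ) ψ φ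
  have hnn : 0 ≤ 1 - ‖⟪ψ, φ⟫_ℂ‖ ^ 2 := by nlinarith [norm_nonneg ⟪ψ, φ⟫_ℂ]
  rcases hnn.eq_or_lt with h0 | h0
  -- When `s = 0` the formula for `|A|` is unavailable, but a self-adjoint `A` with `A³ = 0` is
  -- zero.
  · have h3 := pureState_sub_cube hψ hφ
    rw [← h0, Complex.ofReal_zero, zero_smul] at h3
    have hsa := isSelfAdjoint_pureState_sub ψ φ
    have hA : pureState ψ - pureState φ = 0 := by
      set A := pureState ψ - pureState φ
      have h4 : A * A = 0 := by
        rw [← CStarRing.star_mul_self_eq_zero_iff, star_mul, hsa.star_eq, mul_assoc, h3, mul_zero]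
      rw [← CStarRing.star_mul_self_eq_zero_iff, hsa.star_eq, h4]
    rw [traceDistance, hA, traceNorm, operatorAbs, CFC.abs_zero]
    simp
  · set s := Real.sqrt (1 - ‖⟪ψ, φ⟫_ℂ‖ ^ 2) with hs
    have hs0 : 0 < s := Real.sqrt_pos.2 h0
    have hs2 : s ^ 2 = 1 - ‖⟪ψ, φ⟫_ℂ‖ ^ 2 := Real.sq_sqrt hnn
    obtain ⟨hpos, habs⟩ := operatorAbs_pureState_sub hψ hφ hs0 hs2
    have hsum : HasSum (fun n => (⟪fockState n,
        operatorAbs (pureState ψ - pureState φ) (fockState n)⟫_ℂ).re) (2 * s) := by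
      have h := Complex.hasSum_re ((hasSum_pureState_sub_sq hψ hφ).mul_left (s : ℂ)⁻¹)
      convert h using 1
      · funext n
        rw [habs, _root_.smul_apply, inner_smul_right]
      · rw [← hs2, ← Complex.ofReal_inv, ← Complex.ofReal_mul, Complex.ofReal_re]
        field_simp
    have hterm : ∀ n, 0 ≤ (⟪fockState n,
        operatorAbs (pureState ψ - pureState φ) (fockState n)⟫_ℂ).re := fun n =>
      ((ContinuousLinearMap.nonneg_iff_isPositive _).1 hpos).re_inner_nonneg_right _
    rw [traceDistance, traceNorm, ← ENNReal.ofReal_tsum_of_nonneg hterm hsum.summable,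
      hsum.tsum_eq, ENNReal.div_le_iff (by norm_num) (by norm_num),
      ENNReal.ofReal_mul zero_le_two, ENNReal.ofReal_ofNat, mul_comm]
    refine mul_le_mul_left (ENNReal.ofReal_le_ofReal ?_) _
    refine Real.sqrt_le_iff.2 ⟨norm_nonneg _, ?_⟩
    have h1 : ‖ψ - φ‖ ^ 2 = 2 - 2 * (⟪ψ, φ⟫_ℂ).re := by
      rw [@norm_sub_sq ℂ, hψ, hφ]
      simp only [RCLike.re_to_complex]
      ring
    have h2 : (⟪ψ, φ⟫_ℂ).re ^ 2 ≤ ‖⟪ψ, φ⟫_ℂ‖ ^ 2 :=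
      sq_le_sq' (neg_le_of_abs_le (Complex.abs_re_le_norm _)) (Complex.re_le_norm _)
    -- With `c` the real part, `1 - |⟪ψ, φ⟫|² ≤ 1 - c² ≤ 2 - 2c`, the last step being `(c - 1)² ≥
    -- 0`.
    nlinarith [sq_nonneg ((⟪ψ, φ⟫_ℂ).re - 1)]

end PureStates

/-! ### Approximate preparation of arbitrary states -/

theorem corollary1 (m : ℕ) (T : ℝ) (hT : 0 < T) (ψ : Fock m) (hψ : ‖ψ‖ = 1)
    (ε : ℝ) (hε : 0 < ε) :
    ∃ P : QPPolynomial m, IsHermitianOperator P.toOperator ∧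
      ∃ φ : ℝ → Fock m,
        IsSchrodingerSolution P.toOperator (vacuum m) T φ ∧
        (∀ A : Fock m →ₗ.[ℂ] Fock m, P.toOperator ≤ A → IsHermitianOperator A →
          ∀ χ : ℝ → Fock m, IsSchrodingerSolution A (vacuum m) T χ →
            Set.EqOn χ φ (Set.Icc 0 T)) ∧
        traceDistance (pureState ψ) (pureState (φ T)) ≤ ENNReal.ofReal ε := by
  obtain ⟨y, hy, hy1, hψy, N, hN⟩ := exists_truncation hψ hε
  obtain ⟨P, hP, φ, hφ, hφT⟩ := exists_hamiltonian_evolution hT hy hy1 hN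
  refine ⟨P, hP, φ, hφ, fun A hPA hA χ hχ => (hφ.mono hPA).eqOn hA hχ, ?_⟩
  rw [hφT]
  exact (traceDistance_pureState_le hψ hy1).trans (ENNReal.ofReal_le_ofReal hψy)
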